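/- Let $n$ be a natural number and let $H$ be a complex Hilbert space (for instance a separable infinite-dimensional one). Give $B(H)^n$ the product of the operator norm topologies. For a word $\alpha=g_{i_1}\cdots g_{i_k}$ in $n$ letters put $|\alpha|=k$ and $X_\alpha=X_{i_1}\cdots X_{i_k}$ (the identity if $k=0$). For a formal power series $F=\sum_\alpha a_\alpha Z_\alpha$ with complex coefficients in noncommuting indeterminates $Z_1,\dots,Z_n$, the radius of convergence $r(F)\in[0,\infty]$ is given by $1/r(F)=\limsup_{k\to\infty}\big(\sum_{|\alpha|=k}|a_\alpha|^2\big)^{1/(2k)}$, and for a tuple $f=(f_1,\dots,f_n)$ of such series $r(f)=\min_i r(f_i)$. For $0<\gamma\le\infty$ let $[B(H)^n]_\gamma=\{X\in B(H)^n:\ \|X_1X_1^*+\cdots+X_nX_n^*\|^{1/2}<\gamma\}$. A map $\varphi=(\varphi_1,\dots,\varphi_n):\Omega\to B(H)^n$, where $\Omega\subseteq B(H)^n$ contains $[B(H)^n]_r$ for some $r>0$, is called free holomorphic if for every $i$ there are complex numbers $a^{(i)}_\alpha$ with $\varphi_i(X)=\sum_{k=0}^\infty\sum_{|\alpha|=k}a^{(i)}_\alpha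 X_\alpha$ for all $X\in\Omega$, the series over $k$ converging in operator norm. Let $f=(f_1,\dots,f_n)$ be an $n$-tuple of such formal power series with $r(f)>0$, $f(0)=0$ and $\det J_f(0)\ne 0$, where $J_f(0)=\big[\frac{\partial f_i}{\partial Z_j}(0)\big]$ is formed with the free partial derivatives ($\partial Z_\alpha/\partial Z_j$ is the sum of the words obtained from $Z_\alpha$ by deleting one occurrence of $Z_j$). Let $g=(g_1,\dots,g_n)$ be the inverse of $f$ with respect to composition of power series, i.e. the $n$-tuple of formal power series with $g(0)=0$ and $f\circ g=\mathrm{id}=(Z_1,\dots,Z_n)$, and suppose that $r(g)>0$. Then there are open neighborhoods $D\subseteq[B(H)^n]_{r(f)}$ and $G\subseteq[B(H)^n]_{r(g)}$ of $0$ in $B(H)^n$ such that $X\mapsto f(X)=\big(\sum_{k}\sum_{|\alpha|=k}a^{(i)}_\alpha X_\alpha\big)_{i}$, where $a^{(i)}_\alpha$ are the coefficients of $f_i$, converges on $D$ and defines a bijective free holomorphic map $f|_D:D\to G$, whose inverse $G\to D$ is free holomorphic and equal to $g|_G$, the sum of the series $g$ on $G$ (which converges there). -/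

import Mathlib

open Filter Topology
open scoped ENNReal

namespace FreeHol

/-- A word in the generators `g_1, …, g_n` of the free semigroup with identity (the empty word). -/
abbrev Word (n : ℕ) : Type := List (Fin n)

/-- The finite set of all words `α` of length `|α| = k`. -/
def wordsOfLength (n k : ℕ) : Finset (Word n) :=
  (Finset.univ : Finset (Fin k → Fin n)).map ⟨List.ofFn, List.ofFn_injective⟩

theorem mem_wordsOfLength {n k : ℕ} {α : Word n} : α ∈ wordsOfLength n k ↔ α.length = k := by
  constructor
  · intro h
    obtain ⟨w, -, rfl⟩ := Finset.mem_map.1 h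
    exact List.length_ofFn
  · rintro rfl
    exact Finset.mem_map.2 ⟨α.get, Finset.mem_univ _, List.ofFn_get α⟩

/-- Formal power series `∑ a_α Z_α` with complex coefficients in `n` noncommuting
indeterminates, given by the coefficients `a_α`. -/
def NCSeries (n : ℕ) : Type := Word n → ℂ

namespace NCSeries

variable {n : ℕ}

/-- The constant series `1`. -/
def one : NCSeries n := fun β => if β = [] then 1 else 0

/-- The indeterminate `Z_i`. -/
def Z (i : Fin n) : NCSeries n := fun β => if β = [i] then 1 else 0

/-- The product of series: the coefficient at `β` is the sum of `F_σ G_τ` over all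
factorizations `β = στ`. -/
def mul (F G : NCSeries n) : NCSeries n := fun β =>
  ∑ p ∈ Finset.range (β.length + 1), F (β.take p) * G (β.drop p)

/-- `G_α = G_{i_1} ⋯ G_{i_k}` for `α = g_{i_1} ⋯ g_{i_k}`. -/
def wordProd (G : Fin n → NCSeries n) (α : Word n) : NCSeries n :=
  (α.map G).foldr mul one

/-- The value `F(0)`, i.e. the constant coefficient. -/
def constCoeff (F : NCSeries n) : ℂ := F []

/-- If `G(0) = 0` then `G_α` contains only monomials of degree at least `|α|`. -/
theorem wordProd_eq_zero_of_length_lt {G : Fin n → NCSeries n}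
    (hG : ∀ i, (G i).constCoeff = 0) (α β : Word n) (h : β.length < α.length) :
    wordProd G α β = 0 := by
  induction α generalizing β with
  | nil => simp at h
  | cons i α ih =>
    change ∑ p ∈ Finset.range (β.length + 1), G i (β.take p) * wordProd G α (β.drop p) = 0
    refine Finset.sum_eq_zero fun p hp => ?_
    simp only [List.length_cons] at h
    rcases Nat.eq_zero_or_pos p with rfl | hp0
    · have h0 : G i (β.take 0) = 0 := by simpa [constCoeff] using hG i
      rw [h0, zero_mul]
    · rcases β with _ | ⟨b, β⟩
      · simp at hp
        omega
      · rw [ih _ (by simp only [List.length_drop, List.length_cons] at *; omega), mul_zero]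

/-- The composition `F ∘ G = ∑ a_α G_α` of a series `F = ∑ a_α Z_α` with an `n`-tuple `G` such
that `G(0) = 0`. By `wordProd_eq_zero_of_length_lt` only the words `α` with `|α| ≤ |β|`
contribute to the coefficient at `β`. -/
def comp (F : NCSeries n) (G : Fin n → NCSeries n) : NCSeries n := fun β =>
  ∑ k ∈ Finset.range (β.length + 1), ∑ α ∈ wordsOfLength n k, F α * wordProd G α β

/-- `g` is the inverse of `f` with respect to composition: `g(0) = 0` and `f ∘ g = id`. -/
def IsCompInverse (f g : Fin n → NCSeries n) : Prop :=
  (∀ i, (g i).constCoeff = 0) ∧ ∀ i, comp (f i) g = Z i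

/-- `∂Z_α/∂Z_j`: the sum of the words obtained from `α` by deleting one occurrence of `g_j`. -/
def monomialDeriv (j : Fin n) (α : Word n) : NCSeries n := fun β =>
  ((Finset.range α.length).filter fun p => α[p]? = some j ∧ α.eraseIdx p = β).card

/-- The free partial derivative `∂F/∂Z_j = ∑ a_α ∂Z_α/∂Z_j`; only words `α` with
`|α| = |β| + 1` contribute to the coefficient at `β`. -/
def pderiv (j : Fin n) (F : NCSeries n) : NCSeries n := fun β =>
  ∑ α ∈ wordsOfLength n (β.length + 1), F α * monomialDeriv j α β

/-- The matrix `J_f(0) = [∂f_i/∂Z_j (0)]`. -/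
def jacobianAtZero (f : Fin n → NCSeries n) : Matrix (Fin n) (Fin n) ℂ :=
  Matrix.of fun i j => (pderiv j (f i)).constCoeff

/-- The radius of convergence `r(F)`, with `1 / r(F) = limsup_k (∑_{|α| = k} |a_α|²)^{1/(2k)}`. -/
noncomputable def radius (F : NCSeries n) : ℝ≥0∞ :=
  (limsup (fun k : ℕ => (∑ α ∈ wordsOfLength n k, ‖F α‖ₑ ^ 2) ^ (1 / (2 * (k : ℝ)))) atTop)⁻¹

/-- The radius of convergence of an `n`-tuple: the minimum of the radii of its entries. -/
noncomputable def tupleRadius (f : Fin n → NCSeries n) : ℝ≥0∞ := ⨅ i, (f i).radius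

end NCSeries

section Operators

variable {n : ℕ} {H : Type*} [NormedAddCommGroup H] [InnerProductSpace ℂ H]

/-- `X_α = X_{i_1} ⋯ X_{i_k}` for `α = g_{i_1} ⋯ g_{i_k}`, and the identity for the empty word. -/
def opWord (X : Fin n → H →L[ℂ] H) (α : Word n) : H →L[ℂ] H := (α.map X).prod

/-- `F(X) = T`: the series `∑_k (∑_{|α| = k} a_α X_α)` converges to `T` in operator norm. -/
def HasValue (F : NCSeries n) (X : Fin n → H →L[ℂ] H) (T : H →L[ℂ] H) : Prop :=
  Tendsto (fun N : ℕ => ∑ k ∈ Finset.range N, ∑ α ∈ wordsOfLength n k, F α • opWord X α)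
    atTop (𝓝 T)

/-- The tuple of series `F` represents the map `φ` defined on `Ω`: for every `X ∈ Ω` each series
`F_i` converges at `X`, with sum the `i`-th entry of `φ(X)`. -/
def Represents {Ω : Set (Fin n → H →L[ℂ] H)} (F : Fin n → NCSeries n)
    (φ : Ω → Fin n → H →L[ℂ] H) : Prop :=
  ∀ (X : Ω) (i : Fin n), HasValue (F i) X.1 (φ X i)

variable [CompleteSpace H]

/-- The open operatorial ball of radius `γ ∈ [0, ∞]`:
all `X` with `‖X_1 X_1^* + ⋯ + X_n X_n^*‖^{1/2} < γ`. -/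
def opBall (n : ℕ) (H : Type*) [NormedAddCommGroup H] [InnerProductSpace ℂ H] [CompleteSpace H]
    (γ : ℝ≥0∞) : Set (Fin n → H →L[ℂ] H) :=
  {X | ENNReal.ofReal (Real.sqrt ‖∑ i, X i * ContinuousLinearMap.adjoint (X i)‖) < γ}

/-- An `n`-tuple of free holomorphic functions on a set `Ω` that contains an operatorial ball of
positive radius: every entry is the sum on `Ω` of a noncommutative power series. -/
def IsFreeHolomorphic {Ω : Set (Fin n → H →L[ℂ] H)} (φ : Ω → Fin n → H →L[ℂ] H) : Prop :=
  (∃ r : ℝ≥0∞, 0 < r ∧ opBall n H r ⊆ Ω) ∧ ∃ F : Fin n → NCSeries n, Represents F φ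

end Operators

end FreeHol

/-! Positive radius of convergence gives some `ρ > 0` with `∑ |a_α| ρ^|α| < ∞`. On tuples whose
entries have norm at most `ρ`, the series then converges absolutely over all words, and this
weighted `ℓ¹` norm is submultiplicative. If `g` has weighted norms at most a radius at which `f`
converges absolutely, Fubini turns the formal identity `f ∘ g = id` into `f(g(Y)) = Y` for small
operator tuples `Y` (`eval_comp`).

The other identity needs no formal `g ∘ f = id`. Near `0`, `f` is its linear part, given by the
invertible matrix `J_f(0)`, plus a remainder with small Lipschitz constant, so it is injective and
also continuous (`exists_injOn_continuousOn`). With `G` a small ball and `D` the part of the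
injectivity ball sent into `G`, the tuples `g(f(X))` and `X` have the same image under `f`, hence
agree. -/

namespace FreeHol

/-! ### Sums indexed by words -/

variable {n : ℕ}

/-- Factorizations of words correspond to pairs of words. -/
def splitEquiv (n : ℕ) : (Σ β : Word n, Fin (β.length + 1)) ≃ Word n × Word n where
  toFun x := (x.1.take x.2, x.1.drop x.2)
  invFun y := ⟨y.1 ++ y.2, ⟨y.1.length, by simp only [List.length_append]; omega⟩⟩
  left_inv := by
    rintro ⟨β, p, hp⟩
    have key : ∀ (β' : Word n) (p' : ℕ) (hp' : p' < β'.length + 1), β' = β → p' = p →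
        (⟨β', ⟨p', hp'⟩⟩ : Σ β : Word n, Fin (β.length + 1)) = ⟨β, ⟨p, hp⟩⟩ := by
      rintro _ _ _ rfl rfl
      rfl
    refine key _ _ _ (List.take_append_drop _ _) ?_
    simp only [List.length_take]
    omega
  right_inv := by
    rintro ⟨a, b⟩
    simp

/-- The Cauchy product of two families indexed by words. -/
theorem hasSum_split_mul {A : Type*} [NormedRing A] [CompleteSpace A] {u v : Word n → A}
    (hu : Summable fun β => ‖u β‖) (hv : Summable fun β => ‖v β‖) :
    HasSum (fun β : Word n => ∑ p ∈ Finset.range (β.length + 1), u (β.take p) * v (β.drop p))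
      ((∑' β, u β) * ∑' β, v β) := by
  have h : HasSum (fun x : Word n × Word n => u x.1 * v x.2) ((∑' β, u β) * ∑' β, v β) := by
    rw [tsum_mul_tsum_of_summable_norm hu hv]
    exact (summable_mul_of_summable_norm hu hv).hasSum
  rw [← (splitEquiv n).hasSum_iff] at h
  refine h.sigma fun β => ?_
  rw [Finset.sum_range fun p => u (β.take p) * v (β.drop p)]
  exact hasSum_fintype _

/-- The words of length less than `N` exhaust all words as `N` grows, so unconditional convergence
implies the degree-by-degree convergence required by `HasValue`. -/
theorem hasSum_sum_range_words {E : Type*} [NormedAddCommGroup E] {u : Word n → E} {T : E}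
    (h : HasSum u T) :
    Tendsto (fun N : ℕ => ∑ k ∈ Finset.range N, ∑ α ∈ wordsOfLength n k, u α) atTop (𝓝 T) := by
  classical
  have hd : ∀ N : ℕ, ∑ k ∈ Finset.range N, ∑ α ∈ wordsOfLength n k, u α =
      ∑ α ∈ (Finset.range N).biUnion (wordsOfLength n), u α := by
    intro N
    rw [Finset.sum_biUnion]
    intro i _ j _ hij
    refine Finset.disjoint_left.2 fun α hi hj => hij ?_
    rw [← mem_wordsOfLength.1 hi, ← mem_wordsOfLength.1 hj]
  simp only [hd]
  have h' : Tendsto (fun s : Finset (Word n) => ∑ α ∈ s, u α) atTop (𝓝 T) := by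
    simpa [HasSum] using h
  refine h'.comp (tendsto_atTop_finset_of_monotone ?_ fun α : Word n => ⟨α.length + 1, ?_⟩)
  · intro a b hab
    exact Finset.biUnion_subset_biUnion_of_subset_left _ (Finset.range_mono hab)
  · exact Finset.mem_biUnion.2 ⟨α.length, by simp, mem_wordsOfLength.2 rfl⟩

/-! ### Weighted `ℓ¹` norms of formal series -/

namespace NCSeries

/-- Absolute convergence of `∑ a_α ρ^|α|`. -/
def AbsSummable (F : NCSeries n) (ρ : ℝ) : Prop :=
  Summable fun β : Word n => ‖F β‖ * ρ ^ β.length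

/-- The sum `∑ |a_α| ρ^|α|`. -/
noncomputable def weight (F : NCSeries n) (ρ : ℝ) : ℝ :=
  ∑' β : Word n, ‖F β‖ * ρ ^ β.length

theorem AbsSummable.mono {F : NCSeries n} {ρ δ : ℝ} (h : F.AbsSummable ρ) (h0 : 0 ≤ δ)
    (hδ : δ ≤ ρ) : F.AbsSummable δ :=
  Summable.of_nonneg_of_le (fun β => by positivity) (fun β => by gcongr) h

theorem weight_nonneg (F : NCSeries n) {ρ : ℝ} (h : 0 ≤ ρ) : 0 ≤ F.weight ρ :=
  tsum_nonneg fun β => by positivity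

/-- Every word that contributes is nonempty and so carries at least one factor `s`. This lets the
weight be made arbitrarily small. -/
theorem weight_le_of_constCoeff_eq_zero {F : NCSeries n} (hF : F.constCoeff = 0) {ρ s : ℝ}
    (h : F.AbsSummable ρ) (hρ : 0 ≤ ρ) (hs : 0 ≤ s) (hs1 : s ≤ 1) :
    F.weight (s * ρ) ≤ s * F.weight ρ := by
  unfold weight
  rw [← tsum_mul_left]
  refine Summable.tsum_le_tsum (fun β => ?_)
    (h.mono (by positivity) (mul_le_of_le_one_left hρ hs1)) (h.mul_left s)
  rcases β with _ | ⟨b, β⟩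
  · have : F [] = 0 := hF
    simp [this]
  · have h1 : s ^ (List.length (b :: β)) ≤ s := pow_le_of_le_one hs hs1 (by simp)
    rw [mul_pow]
    calc _ = s ^ (List.length (b :: β)) * (‖F (b :: β)‖ * ρ ^ (List.length (b :: β))) := by ring
      _ ≤ _ := by gcongr

theorem sum_norm_mul_split (F G : NCSeries n) {ρ : ℝ} (hρ : 0 ≤ ρ) (β : Word n) :
    ‖mul F G β‖ * ρ ^ β.length ≤ ∑ p ∈ Finset.range (β.length + 1),
      (‖F (β.take p)‖ * ρ ^ (β.take p).length) * (‖G (β.drop p)‖ * ρ ^ (β.drop p).length) := by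
  have h1 : ‖mul F G β‖ ≤ ∑ p ∈ Finset.range (β.length + 1), ‖F (β.take p)‖ * ‖G (β.drop p)‖ :=
    (norm_sum_le _ _).trans (Finset.sum_le_sum fun p _ => norm_mul_le _ _)
  refine (mul_le_mul_of_nonneg_right h1 (by positivity)).trans ?_
  rw [Finset.sum_mul]
  refine le_of_eq (Finset.sum_congr rfl fun p _ => ?_)
  have h2 : β.length = (β.take p).length + (β.drop p).length := by
    rw [← List.length_append, List.take_append_drop]
  nth_rewrite 1 [h2]
  rw [pow_add]
  ring

theorem AbsSummable.mul_and_weight_le {F G : NCSeries n} {ρ : ℝ} (hρ : 0 ≤ ρ)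
    (hF : F.AbsSummable ρ) (hG : G.AbsSummable ρ) :
    (mul F G).AbsSummable ρ ∧ (mul F G).weight ρ ≤ F.weight ρ * G.weight ρ := by
  have h := hasSum_split_mul (n := n) hF.norm hG.norm
  have hs : (mul F G).AbsSummable ρ := Summable.of_nonneg_of_le (fun β => by positivity)
    (sum_norm_mul_split F G hρ) h.summable
  exact ⟨hs, hasSum_le (sum_norm_mul_split F G hρ) hs.hasSum h⟩

theorem wordProd_absSummable_and_weight_le {G : Fin n → NCSeries n} {ρ t : ℝ} (hρ : 0 ≤ ρ)
    (ht : 0 ≤ t) (hG : ∀ i, (G i).AbsSummable ρ) (hGt : ∀ i, (G i).weight ρ ≤ t) (α : Word n) :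
    (wordProd G α).AbsSummable ρ ∧ (wordProd G α).weight ρ ≤ t ^ α.length := by
  induction α with
  | nil =>
    have h : HasSum (fun β : Word n => ‖wordProd G [] β‖ * ρ ^ β.length) 1 := by
      have := hasSum_single (f := fun β : Word n => ‖wordProd G [] β‖ * ρ ^ β.length) []
        (fun β hβ => by simp [wordProd, one, hβ])
      simpa [wordProd, one] using this
    exact ⟨h.summable, h.tsum_eq.le.trans_eq (pow_zero t).symm⟩
  | cons i α ih =>
    obtain ⟨h1, h2⟩ := AbsSummable.mul_and_weight_le hρ (hG i) ih.1
    refine ⟨h1, h2.trans ?_⟩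
    rw [List.length_cons, pow_succ']
    exact mul_le_mul (hGt i) ih.2 (weight_nonneg _ hρ) ht

/-- The truncation in `comp` drops only zero terms. The untruncated form is what an interchange of
summations can use. -/
theorem hasSum_comp (F : NCSeries n) {G : Fin n → NCSeries n}
    (hG : ∀ i, (G i).constCoeff = 0) (β : Word n) :
    HasSum (fun α : Word n => F α * wordProd G α β) (comp F G β) := by
  have hs : HasSum (fun α : Word n => F α * wordProd G α β)
      (∑' α : Word n, F α * wordProd G α β) := by
    classical
    refine (summable_of_hasFiniteSupport (((Finset.range (β.length + 1)).biUnion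
      (wordsOfLength n)).finite_toSet.subset fun α hα => ?_)).hasSum
    by_contra hmem
    refine hα ?_
    change F α * wordProd G α β = 0
    rw [wordProd_eq_zero_of_length_lt hG α β, mul_zero]
    by_contra hlt
    exact hmem (Finset.mem_coe.2 (Finset.mem_biUnion.2
      ⟨α.length, Finset.mem_range.2 (by omega), mem_wordsOfLength.2 rfl⟩))
  have ht := hasSum_sum_range_words hs
  have hc : Tendsto (fun N : ℕ => ∑ k ∈ Finset.range N, ∑ α ∈ wordsOfLength n k,
      F α * wordProd G α β) atTop (𝓝 (comp F G β)) := by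
    refine tendsto_const_nhds.congr' ?_
    filter_upwards [eventually_ge_atTop (β.length + 1)] with N hN
    refine Finset.sum_subset (Finset.range_mono hN) fun k _ hk => ?_
    refine Finset.sum_eq_zero fun α hα => ?_
    rw [wordProd_eq_zero_of_length_lt hG α β, mul_zero]
    rw [mem_wordsOfLength.1 hα]
    have := Finset.mem_range.not.1 hk
    omega
  rwa [tendsto_nhds_unique ht hc] at hs

/-- There are `n ^ k` words of length `k`, so the sum is geometric with ratio `n / (2(n + 1)) < 1`,
also when `n = 0`. -/
theorem summable_geometric_words (n : ℕ) :
    Summable fun β : Word n => ((2 * ((n : ℝ) + 1))⁻¹) ^ β.length := by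
  rw [← List.equivSigmaTuple.symm.summable_iff]
  refine (summable_sigma_of_nonneg fun _ => by simp only [Function.comp_apply]; positivity).2
    ⟨fun k => (hasSum_fintype _).summable, ?_⟩
  have h : ∀ k : ℕ, (∑' w : Fin k → Fin n, ((fun β : Word n => ((2 * ((n : ℝ) + 1))⁻¹) ^ β.length)
      ∘ List.equivSigmaTuple.symm) ⟨k, w⟩) = ((n : ℝ) * (2 * ((n : ℝ) + 1))⁻¹) ^ k := by
    intro k
    simp [tsum_fintype, List.equivSigmaTuple, mul_pow]
  simp only [h]
  refine summable_geometric_of_lt_one (by positivity) ?_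
  rw [← div_eq_mul_inv, div_lt_one (by positivity)]
  have : (0 : ℝ) ≤ n := Nat.cast_nonneg n
  linarith

/-- A single coefficient is bounded by the `ℓ²` norm of its degree, so `|a_α| ≤ M^|α|` for long
words once `M` exceeds the limsup. A small enough `ρ` also absorbs the number of words. -/
theorem exists_absSummable_of_radius_pos {F : NCSeries n} (h : 0 < F.radius) :
    ∃ ρ : ℝ, 0 < ρ ∧ F.AbsSummable ρ := by
  have hlt : limsup (fun k : ℕ => (∑ α ∈ wordsOfLength n k, ‖F α‖ₑ ^ 2) ^ (1 / (2 * (k : ℝ))))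
      atTop < ⊤ := by
    rw [radius, ENNReal.inv_pos] at h
    exact lt_top_iff_ne_top.2 h
  obtain ⟨M, hM, hMtop⟩ := ENNReal.lt_iff_exists_nnreal_btwn.1 hlt
  have hev := eventually_lt_of_limsup_lt hM
  obtain ⟨N, hN⟩ := eventually_atTop.1 hev
  -- The shift to `N + 1` excludes length `0`, where the exponent `1 / (2k)` takes the default value
  -- `0` and the root says nothing.
  have hbound : ∀ α : Word n, N + 1 ≤ α.length → ‖F α‖ ≤ (M : ℝ) ^ α.length := by
    intro α hα
    have h1 := (hN α.length (by omega)).le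
    have hk : (0 : ℝ) < 2 * (α.length : ℝ) := by
      have : (0 : ℝ) < α.length := by exact_mod_cast (by omega : 0 < α.length)
      positivity
    have h2 : ‖F α‖ₑ ^ 2 ≤ ∑ γ ∈ wordsOfLength n α.length, ‖F γ‖ₑ ^ 2 :=
      Finset.single_le_sum (f := fun γ => ‖F γ‖ₑ ^ 2) (fun _ _ => zero_le)
        (mem_wordsOfLength.2 rfl)
    rw [one_div, ENNReal.rpow_inv_le_iff hk] at h1
    have h3 : ‖F α‖ₑ ^ 2 ≤ ((M : ℝ≥0∞) ^ α.length) ^ 2 := by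
      refine (h2.trans h1).trans_eq ?_
      rw [← pow_mul, ← ENNReal.rpow_natCast]
      congr 1
      push_cast
      ring
    have h4 : ‖F α‖ₑ ≤ (M : ℝ≥0∞) ^ α.length := by
      by_contra hcon
      exact absurd h3 (not_le.2 (ENNReal.pow_lt_pow_left two_ne_zero (not_le.1 hcon)))
    have h5 : ‖F α‖₊ ≤ M ^ α.length := by
      rw [enorm_eq_nnnorm] at h4
      exact_mod_cast h4
    exact_mod_cast h5
  -- Chosen so that `M / q ≤ 1 / (2(n + 1))`, the ratio in `summable_geometric_words`.
  set q : ℝ := 2 * ((n : ℝ) + 1) * ((M : ℝ) + 1) with hq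
  have hqpos : 0 < q := by positivity
  refine ⟨q⁻¹, by positivity, ?_⟩
  have hfin : ∀ᶠ β : Word n in cofinite, N + 1 ≤ β.length := by
    refine (List.finite_length_lt (Fin n) (N + 1)).subset fun β hβ => ?_
    simpa using hβ
  refine Summable.of_norm_bounded_eventually (summable_geometric_words n) ?_
  filter_upwards [hfin] with β hβ
  rw [Real.norm_of_nonneg (by positivity)]
  calc ‖F β‖ * q⁻¹ ^ β.length ≤ (M : ℝ) ^ β.length * q⁻¹ ^ β.length := by
        gcongr
        exact hbound β hβ
    _ = (M * q⁻¹) ^ β.length := (mul_pow _ _ _).symm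
    _ ≤ _ := by
        refine pow_le_pow_left₀ (by positivity) ?_ _
        rw [hq, mul_inv, mul_comm, mul_assoc]
        refine mul_le_of_le_one_right (by positivity) ?_
        rw [inv_mul_le_one₀ (by positivity)]
        linarith

end NCSeries

end FreeHol

/-! ### Evaluation at operator tuples -/

namespace FreeHol

section

variable {n : ℕ} {H : Type*} [NormedAddCommGroup H] [InnerProductSpace ℂ H]

theorem opWord_nil (X : Fin n → H →L[ℂ] H) : opWord X [] = 1 := rfl

theorem opWord_cons (X : Fin n → H →L[ℂ] H) (i : Fin n) (α : Word n) :
    opWord X (i :: α) = X i * opWord X α := by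
  simp [opWord]

theorem opWord_append (X : Fin n → H →L[ℂ] H) (α β : Word n) :
    opWord X (α ++ β) = opWord X α * opWord X β := by
  simp [opWord]

theorem norm_opWord_le {X : Fin n → H →L[ℂ] H} {ρ : ℝ} (hX : ‖X‖ ≤ ρ) (α : Word n) :
    ‖opWord X α‖ ≤ ρ ^ α.length := by
  have hρ : 0 ≤ ρ := (norm_nonneg _).trans hX
  induction α with
  | nil =>
    rw [opWord_nil, List.length_nil, pow_zero]
    exact ContinuousLinearMap.norm_id_le
  | cons i α ih =>
    rw [opWord_cons, List.length_cons, pow_succ']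
    exact (norm_mul_le _ _).trans
      (mul_le_mul ((norm_le_pi_norm X i).trans hX) ih (norm_nonneg _) hρ)

/-- Telescoping: the letters of `X` are exchanged for those of `Y` one at a time. The extra factor
`δ` on the left avoids the exponent `|α| - 1`. -/
theorem norm_opWord_sub_le {X Y : Fin n → H →L[ℂ] H} {δ : ℝ} (hX : ‖X‖ ≤ δ) (hY : ‖Y‖ ≤ δ)
    (α : Word n) :
    ‖opWord X α - opWord Y α‖ * δ ≤ α.length * δ ^ α.length * ‖X - Y‖ := by
  have hδ : 0 ≤ δ := (norm_nonneg _).trans hX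
  induction α with
  | nil => simp [opWord_nil]
  | cons i α ih =>
    have h : opWord X (i :: α) - opWord Y (i :: α) =
        (X i - Y i) * opWord X α + Y i * (opWord X α - opWord Y α) := by
      rw [opWord_cons, opWord_cons]
      noncomm_ring
    have h1 : ‖(X i - Y i) * opWord X α‖ ≤ ‖X - Y‖ * δ ^ α.length :=
      (norm_mul_le _ _).trans (mul_le_mul (norm_le_pi_norm (X - Y) i) (norm_opWord_le hX α)
        (norm_nonneg _) (norm_nonneg _))
    have h2 : ‖Y i * (opWord X α - opWord Y α)‖ ≤ δ * ‖opWord X α - opWord Y α‖ :=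
      (norm_mul_le _ _).trans
        (mul_le_mul_of_nonneg_right ((norm_le_pi_norm Y i).trans hY) (norm_nonneg _))
    rw [h]
    calc _ ≤ (‖X - Y‖ * δ ^ α.length + δ * ‖opWord X α - opWord Y α‖) * δ := by
          gcongr
          exact (norm_add_le _ _).trans (add_le_add h1 h2)
      _ = ‖X - Y‖ * δ ^ α.length * δ + δ * (‖opWord X α - opWord Y α‖ * δ) := by ring
      _ ≤ ‖X - Y‖ * δ ^ α.length * δ + δ * (α.length * δ ^ α.length * ‖X - Y‖) := by gcongr
      _ = _ := by
          rw [List.length_cons]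
          push_cast
          ring

/-- The sum `∑ a_α X_α` over all words. -/
noncomputable def eval (F : NCSeries n) (X : Fin n → H →L[ℂ] H) : H →L[ℂ] H :=
  ∑' β : Word n, F β • opWord X β

theorem eval_Z (X : Fin n → H →L[ℂ] H) (i : Fin n) : eval (NCSeries.Z i) X = X i := by
  rw [eval, tsum_eq_single [i]]
  · simp [NCSeries.Z, opWord]
  · intro β hβ
    simp [NCSeries.Z, hβ]

theorem eval_zero {F : NCSeries n} (hF : F.constCoeff = 0) :
    eval F (0 : Fin n → H →L[ℂ] H) = 0 := by
  have h : ∀ β : Word n, F β • opWord (0 : Fin n → H →L[ℂ] H) β = 0 := by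
    rintro (_ | ⟨i, β⟩)
    · have : F [] = 0 := hF
      simp [this]
    · simp [opWord_cons]
  simp [eval, h]

/-- Deleting one letter leaves the empty word only if the word had length one. -/
theorem jacobianAtZero_apply (f : Fin n → NCSeries n) (i j : Fin n) :
    NCSeries.jacobianAtZero f i j = f i [j] := by
  have hterm : ∀ k : Fin n, NCSeries.monomialDeriv j [k] [] = if k = j then 1 else 0 := by
    intro k
    by_cases h : k = j <;> simp [NCSeries.monomialDeriv, h, Finset.filter_true_of_mem]
  have h : NCSeries.jacobianAtZero f i j =
      ∑ w : Fin 1 → Fin n, f i [w 0] * NCSeries.monomialDeriv j [w 0] [] := by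
    simp [NCSeries.jacobianAtZero, NCSeries.pderiv, NCSeries.constCoeff, wordsOfLength]
  rw [h, ← (Equiv.funUnique (Fin 1) (Fin n)).symm.sum_comp]
  simp [hterm]

variable [CompleteSpace H]

theorem norm_smul_opWord_le (F : NCSeries n) {X : Fin n → H →L[ℂ] H} {ρ : ℝ} (hX : ‖X‖ ≤ ρ)
    (β : Word n) : ‖F β • opWord X β‖ ≤ ‖F β‖ * ρ ^ β.length := by
  rw [norm_smul]
  exact mul_le_mul_of_nonneg_left (norm_opWord_le hX β) (norm_nonneg _)

theorem summable_norm_smul_opWord {F : NCSeries n} {X : Fin n → H →L[ℂ] H} {ρ : ℝ}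
    (hF : F.AbsSummable ρ) (hX : ‖X‖ ≤ ρ) : Summable fun β : Word n => ‖F β • opWord X β‖ :=
  Summable.of_nonneg_of_le (fun _ => norm_nonneg _) (norm_smul_opWord_le F hX) hF

theorem hasSum_eval {F : NCSeries n} {X : Fin n → H →L[ℂ] H} {ρ : ℝ}
    (hF : F.AbsSummable ρ) (hX : ‖X‖ ≤ ρ) :
    HasSum (fun β : Word n => F β • opWord X β) (eval F X) :=
  (summable_norm_smul_opWord hF hX).of_norm.hasSum

theorem hasValue_eval {F : NCSeries n} {X : Fin n → H →L[ℂ] H} {ρ : ℝ}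
    (hF : F.AbsSummable ρ) (hX : ‖X‖ ≤ ρ) : HasValue F X (eval F X) :=
  hasSum_sum_range_words (hasSum_eval hF hX)

theorem norm_eval_le {F : NCSeries n} {X : Fin n → H →L[ℂ] H} {ρ : ℝ}
    (hF : F.AbsSummable ρ) (hX : ‖X‖ ≤ ρ) : ‖eval F X‖ ≤ F.weight ρ :=
  tsum_of_norm_bounded hF.hasSum (norm_smul_opWord_le F hX)

theorem eval_mul {F G : NCSeries n} {X : Fin n → H →L[ℂ] H} {ρ : ℝ} (hF : F.AbsSummable ρ)
    (hG : G.AbsSummable ρ) (hX : ‖X‖ ≤ ρ) :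
    eval (NCSeries.mul F G) X = eval F X * eval G X := by
  have h := hasSum_split_mul (summable_norm_smul_opWord hF hX) (summable_norm_smul_opWord hG hX)
  refine HasSum.tsum_eq (h.congr_fun fun β => ?_)
  rw [NCSeries.mul, Finset.sum_smul]
  refine Finset.sum_congr rfl fun p _ => ?_
  rw [smul_mul_smul_comm, ← opWord_append, List.take_append_drop]

theorem eval_wordProd {G : Fin n → NCSeries n} {X : Fin n → H →L[ℂ] H} {ρ : ℝ}
    (hG : ∀ i, (G i).AbsSummable ρ) (hX : ‖X‖ ≤ ρ) (α : Word n) :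
    eval (NCSeries.wordProd G α) X = opWord (fun i => eval (G i) X) α := by
  have hρ : 0 ≤ ρ := (norm_nonneg _).trans hX
  induction α with
  | nil =>
    rw [opWord_nil, eval, tsum_eq_single []]
    · simp [NCSeries.wordProd, NCSeries.one, opWord_nil]
    · intro β hβ
      simp [NCSeries.wordProd, NCSeries.one, hβ]
  | cons i α ih =>
    rw [opWord_cons, ← ih]
    obtain ⟨t, ht⟩ : ∃ t, ∀ i, (G i).weight ρ ≤ t :=
      ⟨∑ i, (G i).weight ρ, fun i => Finset.single_le_sum
        (f := fun i => (G i).weight ρ) (fun j _ => NCSeries.weight_nonneg _ hρ) (Finset.mem_univ i)⟩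
    exact eval_mul (hG i) (NCSeries.wordProd_absSummable_and_weight_le hρ
      ((NCSeries.weight_nonneg _ hρ).trans (ht i)) hG ht α).1 hX

/-- Substitution of series commutes with evaluation. -/
theorem eval_comp {F : NCSeries n} {G : Fin n → NCSeries n} {X : Fin n → H →L[ℂ] H} {ρ t : ℝ}
    (ht : 0 ≤ t) (hF : F.AbsSummable t) (hG0 : ∀ i, (G i).constCoeff = 0)
    (hG : ∀ i, (G i).AbsSummable ρ) (hGt : ∀ i, (G i).weight ρ ≤ t) (hX : ‖X‖ ≤ ρ) :
    eval (NCSeries.comp F G) X = eval F fun i => eval (G i) X := by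
  have hρ : 0 ≤ ρ := (norm_nonneg _).trans hX
  have hW := NCSeries.wordProd_absSummable_and_weight_le hρ ht hG hGt
  have hWs : ∀ α, Summable fun β : Word n => ‖NCSeries.wordProd G α β‖ * ρ ^ β.length :=
    fun α => (hW α).1
  set u : Word n × Word n → H →L[ℂ] H :=
    fun x => (F x.1 * NCSeries.wordProd G x.1 x.2) • opWord X x.2 with hu
  -- Summing over `β` first leaves at most `‖F α‖ * t ^ |α|`. This majorant justifies both orders of
  -- summation of `u`: `h1` sums over `β` first, `h2` over `α` first.
  have hmaj : Summable fun x : Word n × Word n =>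
      ‖F x.1‖ * (‖NCSeries.wordProd G x.1 x.2‖ * ρ ^ x.2.length) := by
    refine (summable_prod_of_nonneg fun x => by positivity).2
      ⟨fun α => (hWs α).mul_left ‖F α‖, ?_⟩
    refine Summable.of_nonneg_of_le (fun α => tsum_nonneg fun β => by positivity)
      (fun α => ?_) (show Summable fun α : Word n => ‖F α‖ * t ^ α.length from hF)
    dsimp only
    rw [tsum_mul_left]
    exact mul_le_mul_of_nonneg_left (hW α).2 (norm_nonneg _)
  have hsum : Summable u := by
    refine Summable.of_norm_bounded hmaj fun x => ?_
    rw [hu, norm_smul, norm_mul, mul_assoc]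
    gcongr
    exact norm_opWord_le hX _
  have h1 : HasSum (fun α => F α • opWord (fun i => eval (G i) X) α) (∑' x, u x) := by
    refine hsum.hasSum.prod_fiberwise fun α => ?_
    rw [← eval_wordProd hG hX]
    simp only [hu, mul_smul]
    exact (hasSum_eval (hW α).1 hX).const_smul (F α)
  have h2 : HasSum (fun β => NCSeries.comp F G β • opWord X β) (∑' x, u x) := by
    have hswap : HasSum (u ∘ Equiv.prodComm (Word n) (Word n)) (∑' x, u x) :=
      ((Equiv.prodComm (Word n) (Word n)).hasSum_iff (f := u)).2 hsum.hasSum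
    refine hswap.prod_fiberwise fun β => ?_
    exact (NCSeries.hasSum_comp F hG0 β).smul_const (opWord X β)
  exact h2.tsum_eq.trans h1.tsum_eq.symm

/-! ### Local injectivity and continuity -/

/-- The part of degree at least two is Lipschitz with a constant that is small near zero. -/
theorem norm_eval_sub_eval_sub_linear_le {F : NCSeries n} {ρ δ : ℝ} (hF : F.AbsSummable ρ)
    (hδ : 0 < δ) (hδρ : 2 * δ ≤ ρ) {X Y : Fin n → H →L[ℂ] H} (hX : ‖X‖ ≤ δ) (hY : ‖Y‖ ≤ δ) :
    ‖eval F X - eval F Y - ∑ j, F [j] • (X j - Y j)‖ ≤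
      2 * δ / ρ ^ 2 * F.weight ρ * ‖X - Y‖ := by
  classical
  have hρ : 0 < ρ := by linarith
  set S : Finset (Word n) := Finset.univ.image fun j : Fin n => [j]
    with hS
  have hmem : ∀ α : Word n, α ∈ S ↔ α.length = 1 := by
    intro α
    rw [List.length_eq_one_iff]
    simp [hS, eq_comm]
  set d : Word n → H →L[ℂ] H := fun α => F α • (opWord X α - opWord Y α) with hd
  have h1 : HasSum d (eval F X - eval F Y) := by
    have hX' := hasSum_eval hF (hX.trans (by linarith : δ ≤ ρ))
    have hY' := hasSum_eval hF (hY.trans (by linarith : δ ≤ ρ))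
    simpa only [hd, smul_sub] using hX'.sub hY'
  have h2 : HasSum (fun α => if α ∈ S then d α else 0) (∑ j, F [j] • (X j - Y j)) := by
    have := hasSum_sum_of_ne_finset_zero (f := fun α => if α ∈ S then d α else 0) (s := S)
      (L := .unconditional _) fun α hα => by simp [hα]
    convert this using 1
    rw [Finset.sum_congr rfl fun α hα => if_pos hα, hS, Finset.sum_image fun a _ b _ h => by simpa using h]
    simp [opWord]
  have h3 := h1.sub h2
  have hb : HasSum (fun α => 2 * δ / ρ ^ 2 * (‖F α‖ * ρ ^ α.length) * ‖X - Y‖)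
      (2 * δ / ρ ^ 2 * F.weight ρ * ‖X - Y‖) :=
    ((Summable.hasSum hF).mul_left _).mul_right _
  rw [← h3.tsum_eq]
  refine tsum_of_norm_bounded hb fun α => ?_
  by_cases hα : α ∈ S
  · simp only [hα, if_true, sub_self, norm_zero]
    positivity
  simp only [hα, if_false, sub_zero, hd, norm_smul]
  rcases hk : α.length with _ | _ | m
  · rw [List.length_eq_zero_iff.1 hk]
    simp only [opWord_nil, sub_self, norm_zero, mul_zero]
    positivity
  · exact absurd ((hmem α).2 hk) hα
  · have h4 := norm_opWord_sub_le hX hY α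
    rw [hk] at h4
    -- The factor `|α| = m + 2` from telescoping is at most `2 * 2 ^ m`, and `2 ^ m` is absorbed by
    -- `2 * δ ≤ ρ`.
    have h5 : ((m + 1 + 1 : ℕ) : ℝ) * δ ^ m ≤ 2 * ρ ^ m := by
      have h6 : ((m + 1 + 1 : ℕ) : ℝ) ≤ 2 * 2 ^ m := by
        have : m + 1 + 1 ≤ 2 * 2 ^ m := by
          have := (Nat.lt_two_pow_self (n := m + 1))
          rw [pow_succ'] at this
          exact this
        exact_mod_cast this
      calc _ ≤ 2 * 2 ^ m * δ ^ m := by gcongr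
        _ = 2 * (2 * δ) ^ m := by rw [mul_pow]; ring
        _ ≤ _ := by gcongr
    have h7 : ‖opWord X α - opWord Y α‖ ≤ 2 * δ / ρ ^ 2 * ρ ^ (m + 1 + 1) * ‖X - Y‖ := by
      refine le_of_mul_le_mul_right (h4.trans ?_) hδ
      calc ((m + 1 + 1 : ℕ) : ℝ) * δ ^ (m + 1 + 1) * ‖X - Y‖
          = ((m + 1 + 1 : ℕ) : ℝ) * δ ^ m * (δ ^ 2 * ‖X - Y‖) := by ring
        _ ≤ 2 * ρ ^ m * (δ ^ 2 * ‖X - Y‖) := by gcongr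
        _ = _ := by
            field_simp
            ring
    calc _ ≤ ‖F α‖ * (2 * δ / ρ ^ 2 * ρ ^ (m + 1 + 1) * ‖X - Y‖) := by gcongr
      _ = _ := by ring

/-- A tuple of series with invertible Jacobian is injective and continuous near zero. -/
theorem exists_injOn_continuousOn {f : Fin n → NCSeries n} {ρ : ℝ} (hρ : 0 < ρ)
    (hf : ∀ i, (f i).AbsSummable ρ) (hJ : (NCSeries.jacobianAtZero f).det ≠ 0) :
    ∃ δ : ℝ, 0 < δ ∧ δ ≤ ρ ∧
      Set.InjOn (fun (X : Fin n → H →L[ℂ] H) i => eval (f i) X) (Metric.closedBall 0 δ) ∧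
      ContinuousOn (fun (X : Fin n → H →L[ℂ] H) i => eval (f i) X) (Metric.closedBall 0 δ) := by
  set J := NCSeries.jacobianAtZero f with hJdef
  set K : ℝ := ∑ i, ∑ j, ‖J⁻¹ i j‖ with hK
  set W : ℝ := ∑ i, (f i).weight ρ with hW
  have hK0 : 0 ≤ K := by positivity
  have hw0 : ∀ i, 0 ≤ (f i).weight ρ := fun i => NCSeries.weight_nonneg _ hρ.le
  have hW0 : 0 ≤ W := Finset.sum_nonneg fun i _ => hw0 i
  have hwW : ∀ i, (f i).weight ρ ≤ W := fun i =>
    Finset.single_le_sum (f := fun i => (f i).weight ρ) (fun j _ => hw0 j) (Finset.mem_univ i)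
  obtain ⟨δ, hδ, hδρ, hsmall⟩ : ∃ δ : ℝ, 0 < δ ∧ 2 * δ ≤ ρ ∧ K * (2 * δ / ρ ^ 2 * W) < 1 := by
    have hlim : Tendsto (fun δ : ℝ => K * (2 * δ / ρ ^ 2 * W)) (𝓝[>] 0) (𝓝 0) := by
      have : Continuous fun δ : ℝ => K * (2 * δ / ρ ^ 2 * W) := by fun_prop
      simpa using (this.tendsto 0).mono_left nhdsWithin_le_nhds
    have h2 : ∀ᶠ δ : ℝ in 𝓝[>] 0, δ < ρ / 2 :=
      nhdsWithin_le_nhds (eventually_lt_nhds (by positivity))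
    obtain ⟨δ, h3, h4, h5⟩ := ((hlim.eventually_lt_const one_pos).and
      (h2.and self_mem_nhdsWithin)).exists
    exact ⟨δ, h5, by linarith, h3⟩
  have hR : ∀ X ∈ Metric.closedBall (0 : Fin n → H →L[ℂ] H) δ, ∀ Y ∈ Metric.closedBall 0 δ, ∀ i,
      ‖eval (f i) X - eval (f i) Y - ∑ j, f i [j] • (X j - Y j)‖ ≤
        2 * δ / ρ ^ 2 * W * ‖X - Y‖ := by
    intro X hX Y hY i
    rw [mem_closedBall_zero_iff] at hX hY
    refine (norm_eval_sub_eval_sub_linear_le (hf i) hδ hδρ hX hY).trans ?_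
    gcongr
    exact hwW i
  refine ⟨δ, hδ, by linarith, ?_, ?_⟩
  · intro X hX Y hY hXY
    have hinv : J⁻¹ * J = 1 := Matrix.nonsing_inv_mul _ (isUnit_iff_ne_zero.2 hJ)
    -- Applying `J⁻¹` to the linear part recovers `X - Y`.
    have hcoord : ∀ k, X k - Y k = ∑ i, J⁻¹ k i • ∑ j, f i [j] • (X j - Y j) := by
      intro k
      simp only [Finset.smul_sum, smul_smul]
      rw [Finset.sum_comm]
      simp only [← Finset.sum_smul]
      have : ∀ j, ∑ i, J⁻¹ k i * f i [j] = if k = j then 1 else 0 := by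
        intro j
        rw [← Matrix.one_apply, ← hinv, Matrix.mul_apply]
        simp only [hJdef, jacobianAtZero_apply]
      simp [this]
    -- As `f(X) = f(Y)`, the linear part is minus the remainder, so `‖X - Y‖` is at most itself
    -- times a constant below `1`.
    have hle : ‖X - Y‖ ≤ K * (2 * δ / ρ ^ 2 * W) * ‖X - Y‖ := by
      refine (pi_norm_le_iff_of_nonneg (by positivity)).2 fun k => ?_
      rw [Pi.sub_apply, hcoord k]
      calc _ ≤ ∑ i, ‖J⁻¹ k i‖ * (2 * δ / ρ ^ 2 * W * ‖X - Y‖) := by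
            refine norm_sum_le_of_le _ fun i _ => ?_
            rw [norm_smul]
            gcongr
            have h := hR X hX Y hY i
            have h0 : eval (f i) X = eval (f i) Y := congrFun hXY i
            rwa [h0, sub_self, zero_sub, norm_neg] at h
        _ = (∑ i, ‖J⁻¹ k i‖) * (2 * δ / ρ ^ 2 * W * ‖X - Y‖) := by rw [Finset.sum_mul]
        _ ≤ K * (2 * δ / ρ ^ 2 * W * ‖X - Y‖) := by
            gcongr
            exact Finset.single_le_sum (f := fun k => ∑ i, ‖J⁻¹ k i‖)
              (fun _ _ => by positivity) (Finset.mem_univ k)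
        _ = _ := by ring
    have h0 : ‖X - Y‖ = 0 := by
      by_contra hne
      have hpos : 0 < ‖X - Y‖ := lt_of_le_of_ne (norm_nonneg _) (Ne.symm hne)
      exact absurd hle (not_le.2 (mul_lt_of_lt_one_left hpos hsmall))
    exact sub_eq_zero.1 (norm_eq_zero.1 h0)
  · refine continuousOn_pi.2 fun i => ?_
    refine continuousOn_tsum (u := fun β : Word n => ‖f i β‖ * ρ ^ β.length) (fun β => ?_) (hf i)
      fun β X hX => norm_smul_opWord_le (f i) ?_ β
    · have : Continuous fun X : Fin n → H →L[ℂ] H => opWord X β := by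
        induction β with
        | nil => simpa only [opWord_nil] using continuous_const
        | cons j β ih =>
          simp only [opWord_cons]
          exact (continuous_apply j).mul ih
      exact (this.const_smul (f i β)).continuousOn
    · rw [mem_closedBall_zero_iff] at hX
      linarith

/-! ### The operatorial ball and the product norm -/

theorem isOpen_opBall (γ : ℝ≥0∞) : IsOpen (opBall n H γ) := by
  have hc : Continuous fun X : Fin n → H →L[ℂ] H =>
      ENNReal.ofReal (Real.sqrt ‖∑ i, X i * ContinuousLinearMap.adjoint (X i)‖) := by
    refine ENNReal.continuous_ofReal.comp (Real.continuous_sqrt.comp (continuous_norm.comp ?_))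
    refine continuous_finsetSum _ fun i _ => (continuous_apply i).mul ?_
    exact ContinuousLinearMap.adjoint.continuous.comp (continuous_apply i)
  exact isOpen_lt hc continuous_const

theorem zero_mem_opBall {γ : ℝ≥0∞} (hγ : 0 < γ) : (0 : Fin n → H →L[ℂ] H) ∈ opBall n H γ := by
  simpa [opBall] using hγ

/-- Every entry of a tuple is dominated by the row norm. -/
theorem norm_le_sqrt_row (X : Fin n → H →L[ℂ] H) (i : Fin n) :
    ‖X i‖ ≤ Real.sqrt ‖∑ j, X j * ContinuousLinearMap.adjoint (X j)‖ := by
  -- For the adjoint, `‖X_i^* x‖²` is one of the nonnegative summands of `⟨∑ X_j X_j^* x, x⟩`.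
  rw [← LinearIsometryEquiv.norm_map ContinuousLinearMap.adjoint (X i)]
  refine ContinuousLinearMap.opNorm_le_bound _ (Real.sqrt_nonneg _) fun x => ?_
  refine le_of_sq_le_sq ?_ (by positivity)
  rw [mul_pow, Real.sq_sqrt (norm_nonneg _)]
  have h1 : ∀ j, RCLike.re (inner ℂ ((X j * ContinuousLinearMap.adjoint (X j)) x) x) =
      ‖ContinuousLinearMap.adjoint (X j) x‖ ^ 2 := by
    intro j
    rw [mul_apply_eq_comp, ← ContinuousLinearMap.adjoint_inner_right,
      inner_self_eq_norm_sq]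
  calc ‖ContinuousLinearMap.adjoint (X i) x‖ ^ 2
      ≤ ∑ j, ‖ContinuousLinearMap.adjoint (X j) x‖ ^ 2 :=
        Finset.single_le_sum (f := fun j => ‖ContinuousLinearMap.adjoint (X j) x‖ ^ 2)
          (fun _ _ => by positivity) (Finset.mem_univ i)
    _ = RCLike.re (inner ℂ ((∑ j, X j * ContinuousLinearMap.adjoint (X j)) x) x) := by
        rw [_root_.sum_apply, sum_inner, map_sum]
        exact Finset.sum_congr rfl fun j _ => (h1 j).symm
    _ ≤ ‖(∑ j, X j * ContinuousLinearMap.adjoint (X j)) x‖ * ‖x‖ := re_inner_le_norm _ _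
    _ ≤ ‖∑ j, X j * ContinuousLinearMap.adjoint (X j)‖ * ‖x‖ * ‖x‖ := by
        gcongr
        exact ContinuousLinearMap.le_opNorm _ _
    _ = _ := by ring

theorem exists_opBall_subset {D : Set (Fin n → H →L[ℂ] H)} (hD : D ∈ 𝓝 0) :
    ∃ r : ℝ≥0∞, 0 < r ∧ opBall n H r ⊆ D := by
  obtain ⟨ε, hε, hball⟩ := Metric.mem_nhds_iff.1 hD
  refine ⟨ENNReal.ofReal ε, ENNReal.ofReal_pos.2 hε, fun X hX => hball ?_⟩
  rw [mem_ball_zero_iff, pi_norm_lt_iff hε]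
  exact fun i => (norm_le_sqrt_row X i).trans_lt ((ENNReal.ofReal_lt_ofReal_iff hε).1 hX)

/-! ### Choice of radii -/

theorem exists_absSummable_of_tupleRadius_pos {f : Fin n → NCSeries n}
    (h : 0 < NCSeries.tupleRadius f) : ∃ ρ : ℝ, 0 < ρ ∧ ∀ i, (f i).AbsSummable ρ := by
  have hi : ∀ i, ∃ ρ : ℝ, 0 < ρ ∧ (f i).AbsSummable ρ := fun i =>
    NCSeries.exists_absSummable_of_radius_pos (h.trans_le (iInf_le _ i))
  choose ρ hρ hs using hi
  -- Choosing `δ` eventually small covers `n = 0`, where there is no minimum of the `ρ i` to take.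
  obtain ⟨δ, hδ, hδρ⟩ : ∃ δ : ℝ, 0 < δ ∧ ∀ i, δ ≤ ρ i := by
    have hev : ∀ᶠ δ : ℝ in 𝓝[>] 0, ∀ i, δ ≤ ρ i := eventually_all.2 fun i =>
      nhdsWithin_le_nhds ((eventually_lt_nhds (hρ i)).mono fun _ => le_of_lt)
    obtain ⟨δ, h1, h2⟩ := (hev.and self_mem_nhdsWithin).exists
    exact ⟨δ, h2, h1⟩
  exact ⟨δ, hδ, fun i => (hs i).mono hδ.le (hδρ i)⟩

theorem exists_weight_lt {g : Fin n → NCSeries n} (hg0 : ∀ i, (g i).constCoeff = 0) {ρ t η : ℝ}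
    (hρ : 0 < ρ) (ht : 0 < t) (hη : 0 < η) (hg : ∀ i, (g i).AbsSummable ρ) :
    ∃ δ : ℝ, 0 < δ ∧ δ ≤ η ∧ (∀ i, (g i).AbsSummable δ) ∧ ∀ i, (g i).weight δ < t := by
  have hlim : ∀ i, ∀ᶠ s : ℝ in 𝓝[>] 0, s * (g i).weight ρ < t := by
    intro i
    have hc : Continuous fun s : ℝ => s * (g i).weight ρ := by fun_prop
    have h0 : Tendsto (fun s : ℝ => s * (g i).weight ρ) (𝓝[>] 0) (𝓝 0) := by
      simpa using (hc.tendsto 0).mono_left nhdsWithin_le_nhds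
    exact h0.eventually_lt_const ht
  have h1 : ∀ᶠ s : ℝ in 𝓝[>] 0, s < 1 := nhdsWithin_le_nhds (eventually_lt_nhds one_pos)
  have h2 : ∀ᶠ s : ℝ in 𝓝[>] 0, s < η / ρ :=
    nhdsWithin_le_nhds (eventually_lt_nhds (by positivity))
  obtain ⟨s, hs, hs1, hsη, hs0⟩ :=
    ((eventually_all.2 hlim).and (h1.and (h2.and self_mem_nhdsWithin))).exists
  have hs0' : 0 < s := hs0
  refine ⟨s * ρ, by positivity, ((lt_div_iff₀ hρ).1 hsη).le, fun i => (hg i).mono (by positivity)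
    (mul_le_of_le_one_left hρ.le hs1.le), fun i => ?_⟩
  exact (NCSeries.weight_le_of_constCoeff_eq_zero (hg0 i) (hg i) hρ.le hs0'.le hs1.le).trans_lt
    (hs i)

end

end FreeHol

/-! ### Construction of the neighborhoods and of the inverse -/

theorem mainTheorem3 {n : ℕ} {H : Type*} [NormedAddCommGroup H] [InnerProductSpace ℂ H]
    [CompleteSpace H] (f g : Fin n → FreeHol.NCSeries n)
    (hf : 0 < FreeHol.NCSeries.tupleRadius f)
    (hf0 : ∀ i, (f i).constCoeff = 0)
    (hJ : (FreeHol.NCSeries.jacobianAtZero f).det ≠ 0)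
    (hfg : FreeHol.NCSeries.IsCompInverse f g)
    (hg : 0 < FreeHol.NCSeries.tupleRadius g) :
    ∃ D G : Set (Fin n → H →L[ℂ] H),
      IsOpen D ∧ 0 ∈ D ∧ D ⊆ FreeHol.opBall n H (FreeHol.NCSeries.tupleRadius f) ∧
      IsOpen G ∧ 0 ∈ G ∧ G ⊆ FreeHol.opBall n H (FreeHol.NCSeries.tupleRadius g) ∧
      ∃ e : D ≃ G,
        FreeHol.IsFreeHolomorphic (fun X : D => (e X : Fin n → H →L[ℂ] H)) ∧
        FreeHol.Represents f (fun X : D => (e X : Fin n → H →L[ℂ] H)) ∧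
        FreeHol.IsFreeHolomorphic (fun Y : G => (e.symm Y : Fin n → H →L[ℂ] H)) ∧
        FreeHol.Represents g (fun Y : G => (e.symm Y : Fin n → H →L[ℂ] H)) := by
  obtain ⟨hg0, hcomp⟩ := hfg
  obtain ⟨ρ, hρ, hfρ⟩ := FreeHol.exists_absSummable_of_tupleRadius_pos hf
  obtain ⟨σ, hσ, hgσ⟩ := FreeHol.exists_absSummable_of_tupleRadius_pos hg
  obtain ⟨δ, hδ, hδρ, hinj, hcont⟩ := FreeHol.exists_injOn_continuousOn (H := H) hρ hfρ hJ
  obtain ⟨ε, hε, hεball⟩ := Metric.isOpen_iff.1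
    (FreeHol.isOpen_opBall (n := n) (H := H) (FreeHol.NCSeries.tupleRadius f)) 0
    (FreeHol.zero_mem_opBall hf)
  obtain ⟨η, hη, hηball⟩ := Metric.isOpen_iff.1
    (FreeHol.isOpen_opBall (n := n) (H := H) (FreeHol.NCSeries.tupleRadius g)) 0
    (FreeHol.zero_mem_opBall hg)
  set d : ℝ := min δ ε with hd
  have hd0 : 0 < d := lt_min hδ hε
  have hdδ : d ≤ δ := min_le_left _ _
  have hfd : ∀ i, (f i).AbsSummable d := fun i => (hfρ i).mono hd0.le (hdδ.trans hδρ)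
  -- Weights below `d` make `g` map the `τ`-ball into the `d`-ball, and also permit the substitution
  -- of `g` into `f`.
  obtain ⟨τ, hτ, hτη, hgτ, hgd⟩ := FreeHol.exists_weight_lt hg0 hσ hd0 hη hgσ
  set φ : (Fin n → H →L[ℂ] H) → Fin n → H →L[ℂ] H := fun X i => FreeHol.eval (f i) X with hφ
  set ψ : (Fin n → H →L[ℂ] H) → Fin n → H →L[ℂ] H := fun X i => FreeHol.eval (g i) X with hψ
  have hψd : ∀ Y ∈ Metric.ball (0 : Fin n → H →L[ℂ] H) τ, ψ Y ∈ Metric.ball 0 d := by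
    intro Y hY
    rw [mem_ball_zero_iff] at hY ⊢
    exact (pi_norm_lt_iff hd0).2 fun i =>
      (FreeHol.norm_eval_le (hgτ i) hY.le).trans_lt (hgd i)
  have hφψ : ∀ Y ∈ Metric.ball (0 : Fin n → H →L[ℂ] H) τ, φ (ψ Y) = Y := by
    intro Y hY
    rw [mem_ball_zero_iff] at hY
    funext i
    rw [← FreeHol.eval_Z Y i, ← hcomp i]
    exact (FreeHol.eval_comp hd0.le (hfd i) hg0 hgτ (fun j => (hgd j).le) hY.le).symm
  have hsub : Metric.ball (0 : Fin n → H →L[ℂ] H) d ⊆ Metric.closedBall 0 δ :=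
    Metric.ball_subset_closedBall.trans (Metric.closedBall_subset_closedBall hdδ)
  set G : Set (Fin n → H →L[ℂ] H) := Metric.ball 0 τ with hG
  set D : Set (Fin n → H →L[ℂ] H) := Metric.ball 0 d ∩ φ ⁻¹' G with hD
  have hDopen : IsOpen D :=
    (hcont.mono hsub).isOpen_inter_preimage Metric.isOpen_ball Metric.isOpen_ball
  have hφ0 : φ 0 = 0 := funext fun i => FreeHol.eval_zero (hf0 i)
  have hG0 : (0 : Fin n → H →L[ℂ] H) ∈ G := Metric.mem_ball_self hτ
  have hD0 : (0 : Fin n → H →L[ℂ] H) ∈ D :=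
    ⟨Metric.mem_ball_self hd0, by rw [Set.mem_preimage, hφ0]; exact hG0⟩
  have hψD : ∀ Y ∈ G, ψ Y ∈ D := fun Y hY =>
    ⟨hψd Y hY, by rw [Set.mem_preimage, hφψ Y hY]; exact hY⟩
  let e : D ≃ G :=
    { toFun := fun X => ⟨φ X.1, X.2.2⟩
      invFun := fun Y => ⟨ψ Y.1, hψD Y.1 Y.2⟩
      -- Both `ψ (φ X)` and `X` lie in the ball where `φ` is injective, and `φ (ψ (φ X)) = φ X`.
      left_inv := fun X => Subtype.ext
        (hinj (hsub (hψd _ X.2.2)) (hsub X.2.1) (hφψ _ X.2.2))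
      right_inv := fun Y => Subtype.ext (hφψ Y.1 Y.2) }
  have hef : FreeHol.Represents f (fun X : D => (e X : Fin n → H →L[ℂ] H)) := fun X i =>
    FreeHol.hasValue_eval (hfd i) (mem_ball_zero_iff.1 X.2.1).le
  have heg : FreeHol.Represents g (fun Y : G => (e.symm Y : Fin n → H →L[ℂ] H)) := fun Y i =>
    FreeHol.hasValue_eval (hgτ i) (mem_ball_zero_iff.1 Y.2).le
  have hGopen : IsOpen G := Metric.isOpen_ball
  exact ⟨D, G, hDopen, hD0, fun X hX => hεball (Metric.ball_subset_ball (min_le_right _ _) hX.1),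
    hGopen, hG0, fun Y hY => hηball (Metric.ball_subset_ball hτη hY), e,
    ⟨FreeHol.exists_opBall_subset (hDopen.mem_nhds hD0), f, hef⟩, hef,
    ⟨FreeHol.exists_opBall_subset (hGopen.mem_nhds hG0), g, heg⟩, heg⟩
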